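/- A meromorphic inner function (MIF) is a bounded analytic function $\Theta$ on $\mathbb C_+=\{\operatorname{Im} z>0\}$ whose boundary values have modulus $1$ almost everywhere on $\mathbb R$ and which continues meromorphically to $\mathbb C$; its spectrum is $\sigma(\Theta)=\{x\in\mathbb R:\Theta(x)=1\}$. A set $\Lambda\subset\mathbb R$ is separated if there is $\delta>0$ with $|\lambda-\lambda'|>\delta$ for all distinct $\lambda,\lambda'\in\Lambda$. Its counting function $n_\Lambda$ is then the step function that jumps by $1$ at each point of $\Lambda$ and is $0$ at $0$ (so, with the right-continuous choice, $n_\Lambda(x)=\#(\Lambda\cap(0,x])$ for $x\ge 0$ and $n_\Lambda(x)=-\#(\Lambda\cap(x,0])$ for $x<0$). A separated set $\Lambda$ is $1$-regular if $$\int_{\mathbb R}\frac{|n_\Lambda(x)-x|}{1+x^2}\,dx<\infty .$$ Let $A=\{2^{3^k}+m : k\ge 1,\ 1\le m\le k\}$ and let $\mathbb N=\{1,2,3,\dots\}$. (1) The one-sided set $\Lambda=\mathbb N\setminus A$ is separated and regular on the half-line, i.e. $$\int_0^\infty\frac{|n_\Lambda(x)-x|}{1+x^2}\,dx<\infty ,$$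 and for every MIF $\Theta$ with $\sigma(\Theta)=\Lambda$ the derivative $\Theta'$ is unbounded on $\mathbb R$. (2) The two-sided set $\tilde\Lambda=\mathbb Z\setminus A$ is separated and $1$-regular, and for every MIF $\Theta$ with $\sigma(\Theta)=\tilde\Lambda$ the derivative $\Theta'$ is unbounded on $\mathbb R$. In particular, a $1$-regular set need not be the spectrum of any MIF with bounded derivative on $\mathbb R$. -/

import Mathlib

open Set Filter Topology MeasureTheory

noncomputable section

namespace MIF

/-- The open upper half-plane as a subset of the complex plane. -/
def upperHalf : Set ℂ := {z : ℂ | 0 < z.im}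

/-- An inner function on the upper half-plane: bounded and analytic there, with boundary values
of modulus one at almost every point of the real line. -/
structure IsInner (Θ : ℂ → ℂ) : Prop where
  analytic : AnalyticOnNhd ℂ Θ upperHalf
  bounded : ∃ C : ℝ, ∀ z ∈ upperHalf, ‖Θ z‖ ≤ C
  unimodular : ∀ᵐ x : ℝ,
    Tendsto (fun y : ℝ => ‖Θ ((x : ℂ) + (y : ℂ) * Complex.I)‖) (𝓝[>] 0) (𝓝 1)

/-- A meromorphic inner function, identified with its meromorphic continuation to the whole plane.
Normal form means that removable singularities are filled in, so that the values on the real line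
(where boundedness in the upper half-plane excludes poles) are those of the analytic function. -/
structure IsMIF (Θ : ℂ → ℂ) : Prop where
  inner : IsInner Θ
  meromorphic : MeromorphicNFOn Θ univ

/-- The spectrum of a meromorphic inner function: the real points where it takes the value 1. -/
def spec (Θ : ℂ → ℂ) : Set ℝ := {x : ℝ | Θ (x : ℂ) = 1}

/-- The derivative is uniformly bounded on the real line. -/
def HasBoundedDeriv (Θ : ℂ → ℂ) : Prop := ∃ C : ℝ, ∀ x : ℝ, ‖deriv Θ (x : ℂ)‖ ≤ C

/-- Distinct points of the set keep a fixed positive distance. -/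
def IsSeparated (S : Set ℝ) : Prop :=
  ∃ δ : ℝ, 0 < δ ∧ ∀ x ∈ S, ∀ y ∈ S, x ≠ y → δ < |x - y|

/-- The counting function of a separated set: the (right-continuous) step function that jumps by one
at each point of the set and vanishes at 0. -/
def counting (S : Set ℝ) (x : ℝ) : ℝ :=
  if 0 ≤ x then ((S ∩ Ioc 0 x).ncard : ℝ) else -((S ∩ Ioc x 0).ncard : ℝ)

/-- A separated set `S` is `a`-regular if `|n_S(x) - a x| / (1 + x ^ 2)` is integrable on the line. -/
def IsRegular (a : ℝ) (S : Set ℝ) : Prop :=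
  IsSeparated S ∧ Integrable (fun x : ℝ => |counting S x - a * x| / (1 + x ^ 2)) volume

/-- The one-sided version of regularity, for sets of positive numbers: the same function is
integrable on the positive half-line. -/
def IsOneSidedRegular (a : ℝ) (S : Set ℝ) : Prop :=
  S ⊆ Ioi 0 ∧ IsSeparated S ∧
    IntegrableOn (fun x : ℝ => |counting S x - a * x| / (1 + x ^ 2)) (Ioi 0) volume

/-- The removed points `2 ^ (3 ^ k) + m` with `1 ≤ m ≤ k`. -/
def removed : Set ℝ :=
  {x : ℝ | ∃ k m : ℕ, 1 ≤ m ∧ m ≤ k ∧ x = 2 ^ (3 ^ k) + (m : ℝ)}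

/-- The positive integers without the removed points. -/
def oneSidedSeq : Set ℝ := {x : ℝ | ∃ n : ℕ, 1 ≤ n ∧ x = (n : ℝ)} \ removed

/-- All integers without the removed points. -/
def twoSidedSeq : Set ℝ := range (fun n : ℤ => (n : ℝ)) \ removed

end MIF

end

namespace MIF

open ComplexConjugate

/-! Suppose |Θ'| ≤ C on ℝ and put m = i(1+Θ)/(1-Θ). Then Im m ≥ 0 on the upper half-plane, m is real
on ℝ off the spectrum, and at each spectral point x it has a simple pole with principal part `mass Θ
x`/(x - z), where the mass 2/|Θ'(x)| is at least 2/C. Finitely many principal parts can be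
subtracted without losing Im ≥ 0 (`julia`, `sum_poles_im_le`), so what remains is nondecreasing on
every real interval free of the spectrum.

Take L = 2^(3^k): the k+1 points L, L-1, ..., L-k are spectral and (L, L+k+1) is a gap. Removing
those k+1 poles shows that m grows by at least (2/C)(H_{k+1} - 2) from L+1/4 to L+k+3/4, H being the
harmonic number (`gap_increase`). On the other hand m is controlled at both ends of the gap. The
unit interval on the far side of each end contains a zero μ of m, i.e. Θ(μ) = -1. The bound on Θ'
keeps μ at distance at least 2/C from that end p and makes the mass at p at most C/2, so m(L+1/4) is
bounded below and m(L+k+3/4) above, independently of k (`le_right_of_spec`, `left_of_spec_le`).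
Divergence of the harmonic series gives the contradiction.

Regularity holds because the removed blocks are sparse: at most √x removed points lie in (0, x], so
the integrand is O(|x|^(-3/2)). -/

/-! ### Schwarz-Pick, Julia's lemma and removal of poles -/

lemma normSq_sub_conj (z w : ℂ) :
    ‖z - conj w‖ ^ 2 = ‖z - w‖ ^ 2 + 4 * (z.im * w.im) := by
  rw [← Complex.normSq_eq_norm_sq, ← Complex.normSq_eq_norm_sq, Complex.normSq_apply,
    Complex.normSq_apply]
  simp
  ring

lemma sub_conj_ne_zero {z w : ℂ} (hz : 0 < z.im) (hw : 0 < w.im) : z - conj w ≠ 0 := by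
  intro h
  have := congrArg Complex.im h
  simp at this
  linarith

/-- The Cayley parametrization of the upper half-plane by the unit disc, centred at `w`. -/
lemma im_cayley_pos {w ζ : ℂ} (hw : 0 < w.im) (hζ : ‖ζ‖ < 1) :
    0 < ((w - conj w * ζ) / (1 - ζ)).im := by
  have h1 : 1 - ζ ≠ 0 := by
    intro h
    rw [← sub_eq_zero.1 h] at hζ
    simp at hζ
  have h2 : 0 < Complex.normSq (1 - ζ) := Complex.normSq_pos.2 h1
  have h3 : Complex.normSq ζ < 1 := by
    rw [Complex.normSq_eq_norm_sq]
    nlinarith [norm_nonneg ζ]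
  have h4 : ((w - conj w * ζ) / (1 - ζ)).im
      = w.im * (1 - Complex.normSq ζ) / Complex.normSq (1 - ζ) := by
    rw [Complex.div_im]
    simp only [Complex.sub_im, Complex.sub_re, Complex.mul_im, Complex.mul_re, Complex.conj_re,
      Complex.conj_im, Complex.one_re, Complex.one_im, Complex.normSq_apply ζ]
    ring
  rw [h4]
  exact div_pos (mul_pos hw (by linarith)) h2

lemma norm_cayley_lt_one {z w : ℂ} (hz : 0 < z.im) (hw : 0 < w.im) :
    ‖(z - w) / (z - conj w)‖ < 1 := by
  have h := norm_pos_iff.2 (sub_conj_ne_zero hz hw)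
  rw [norm_div, div_lt_one h]
  have := normSq_sub_conj z w
  have := mul_pos hz hw
  exact lt_of_pow_lt_pow_left₀ 2 h.le (by linarith)

/-- The Schwarz-Pick inequality for self-maps of the upper half-plane. -/
lemma schwarz_pick_of_pos {f : ℂ → ℂ} (hf : DifferentiableOn ℂ f upperHalf)
    (hpos : ∀ z ∈ upperHalf, 0 < (f z).im) {z w : ℂ} (hz : 0 < z.im) (hw : 0 < w.im) :
    ‖f z - conj (f w)‖ ^ 2 * (z.im * w.im) ≤ (f z).im * (f w).im * ‖z - conj w‖ ^ 2 := by
  -- φ sends 0 to w and g recentres the values at f w, so g is a disc map fixing 0 and Schwarz's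
  -- lemma applies to it.
  set φ : ℂ → ℂ := fun ζ => (w - conj w * ζ) / (1 - ζ) with hφ
  set g : ℂ → ℂ := fun ζ => (f (φ ζ) - f w) / (f (φ ζ) - conj (f w)) with hg
  have hφm : ∀ ζ ∈ Metric.ball (0 : ℂ) 1, φ ζ ∈ upperHalf := fun ζ hζ =>
    im_cayley_pos hw (by simpa using hζ)
  have hd : DifferentiableOn ℂ φ (Metric.ball 0 1) := by
    refine DifferentiableOn.div (by fun_prop) (by fun_prop) ?_
    intro ζ hζ h
    rw [← sub_eq_zero.1 h] at hζ
    simp at hζ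
  have hfd : DifferentiableOn ℂ (fun ζ => f (φ ζ)) (Metric.ball 0 1) := hf.comp hd hφm
  have hgd : DifferentiableOn ℂ g (Metric.ball 0 1) :=
    (hfd.sub_const _).div (hfd.sub_const _)
      fun ζ hζ => sub_conj_ne_zero (hpos _ (hφm ζ hζ)) (hpos w hw)
  have hgm : MapsTo g (Metric.ball 0 1) (Metric.closedBall 0 1) := fun ζ hζ =>
    mem_closedBall_zero_iff.2 (norm_cayley_lt_one (hpos _ (hφm ζ hζ)) (hpos w hw)).le
  have hzw := sub_conj_ne_zero hz hw
  have hww := sub_conj_ne_zero hw hw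
  have h0 : g 0 = 0 := by simp [hg, hφ]
  have key := Complex.norm_le_norm_of_mapsTo_ball hgd hgm h0 (norm_cayley_lt_one hz hw)
  have hφz : φ ((z - w) / (z - conj w)) = z := by
    have h1 : 1 - (z - w) / (z - conj w) = (w - conj w) / (z - conj w) := by
      field_simp
      ring
    simp only [hφ]
    rw [h1, div_eq_iff (div_ne_zero hww hzw)]
    field_simp
    ring
  have hfz := norm_pos_iff.2 (sub_conj_ne_zero (hpos z hz) (hpos w hw))
  simp only [hg] at key
  rw [hφz, norm_div, norm_div, div_le_div_iff₀ hfz (norm_pos_iff.2 hzw)] at key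
  have k2 := pow_le_pow_left₀ (by positivity) key 2
  rw [mul_pow, mul_pow] at k2
  -- These identities trade |z - w| for |z - conj w|, which survives the limit w → x in ℝ.
  have e1 := normSq_sub_conj z w
  have e2 := normSq_sub_conj (f z) (f w)
  have e3 : ‖z - w‖ ^ 2 = ‖z - conj w‖ ^ 2 - 4 * (z.im * w.im) := by linarith
  have e4 : ‖f z - f w‖ ^ 2 = ‖f z - conj (f w)‖ ^ 2 - 4 * ((f z).im * (f w).im) := by linarith
  rw [e3, e4] at k2
  nlinarith

/-- The strict version is applied to f + iε, and then ε → 0. -/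
lemma schwarz_pick {f : ℂ → ℂ} (hf : DifferentiableOn ℂ f upperHalf)
    (hpos : ∀ z ∈ upperHalf, 0 ≤ (f z).im) {z w : ℂ} (hz : 0 < z.im) (hw : 0 < w.im) :
    ‖f z - conj (f w)‖ ^ 2 * (z.im * w.im) ≤ (f z).im * (f w).im * ‖z - conj w‖ ^ 2 := by
  have hlim : ∀ u : ℂ, Tendsto (fun ε : ℝ => u + ε * Complex.I) (𝓝[>] 0) (𝓝 u) := fun u =>
    (Continuous.tendsto' (by fun_prop) 0 u (by simp)).mono_left nhdsWithin_le_nhds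
  have hc : Continuous (conj : ℂ → ℂ) := Complex.continuous_conj
  refine le_of_tendsto_of_tendsto
    ((((hlim (f z)).sub ((hc.tendsto _).comp (hlim (f w)))).norm.pow 2).mul_const (z.im * w.im))
    ((((Complex.continuous_im.tendsto _).comp (hlim (f z))).mul
      ((Complex.continuous_im.tendsto _).comp (hlim (f w)))).mul_const (‖z - conj w‖ ^ 2)) ?_
  filter_upwards [self_mem_nhdsWithin] with ε hε
  have hε' : 0 < ε := hε
  exact schwarz_pick_of_pos (f := fun u => f u + ε * Complex.I) (hf.add_const _)
    (fun u hu => by simpa using add_pos_of_nonneg_of_pos (hpos u hu) hε') hz hw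

/-- The approach to the real point `x` along the vertical half-line. -/
lemma tendsto_vertical (x : ℝ) :
    Tendsto (fun y : ℝ => (x : ℂ) + y * Complex.I) (𝓝[>] 0) (𝓝 (x : ℂ)) :=
  (Continuous.tendsto' (by fun_prop) 0 _ (by simp)).mono_left nhdsWithin_le_nhds

lemma tendsto_ofReal_mul_zero (c : ℂ) :
    Tendsto (fun y : ℝ => (y : ℂ) * c) (𝓝[>] 0) (𝓝 0) :=
  (Continuous.tendsto' (by fun_prop) 0 _ (by simp)).mono_left nhdsWithin_le_nhds

/-- Schwarz-Pick for `z` and `x + i y`, rescaled by the height `y`. -/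
lemma schwarz_pick_vertical {f : ℂ → ℂ} (hf : DifferentiableOn ℂ f upperHalf)
    (hpos : ∀ z ∈ upperHalf, 0 ≤ (f z).im) {z : ℂ} (hz : 0 < z.im) (x : ℝ) {y : ℝ}
    (hy0 : 0 < y) :
    ‖(y : ℂ) * f z - conj ((y : ℂ) * f (x + y * Complex.I))‖ ^ 2 * z.im ≤
      (f z).im * ((y : ℂ) * f (x + y * Complex.I)).im * ‖z - conj (x + y * Complex.I)‖ ^ 2 := by
  set w : ℂ := x + y * Complex.I with hw
  have hwim : w.im = y := by simp [hw]
  have h := schwarz_pick hf hpos hz (w := w) (by rw [hwim]; exact hy0)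
  rw [hwim] at h
  have e1 : ‖(y : ℂ) * f z - conj ((y : ℂ) * f w)‖ = y * ‖f z - conj (f w)‖ := by
    rw [map_mul, Complex.conj_ofReal, ← mul_sub, norm_mul, Complex.norm_of_nonneg hy0.le]
  have e2 : ((y : ℂ) * f w).im = y * (f w).im := by simp
  rw [e1, e2]
  nlinarith

/-- Julia's lemma for a function with nonnegative imaginary part. -/
lemma julia {f : ℂ → ℂ} (hf : DifferentiableOn ℂ f upperHalf)
    (hpos : ∀ z ∈ upperHalf, 0 ≤ (f z).im) {x α : ℝ} (hα : 0 < α)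
    (hlim : Tendsto (fun y : ℝ => (y : ℂ) * f (x + y * Complex.I)) (𝓝[>] 0)
      (𝓝 (α * Complex.I))) {z : ℂ} (hz : 0 < z.im) :
    α * (1 / ((x : ℂ) - z)).im ≤ (f z).im := by
  have hc : Continuous (conj : ℂ → ℂ) := Complex.continuous_conj
  -- Rescaled Schwarz-Pick in the limit y → 0: y f(z) vanishes and y f(x + iy) tends to iα.
  have key : ‖0 - conj ((α : ℂ) * Complex.I)‖ ^ 2 * z.im
      ≤ (f z).im * ((α : ℂ) * Complex.I).im * ‖z - conj (x : ℂ)‖ ^ 2 := by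
    refine le_of_tendsto_of_tendsto
      ((((tendsto_ofReal_mul_zero (f z)).sub
        ((hc.tendsto _).comp hlim)).norm.pow 2).mul_const z.im)
      ((((Complex.continuous_im.tendsto _).comp hlim).const_mul (f z).im).mul
        ((tendsto_const_nhds.sub ((hc.tendsto _).comp (tendsto_vertical x))).norm.pow 2)) ?_
    filter_upwards [self_mem_nhdsWithin] with y hy0
    exact schwarz_pick_vertical hf hpos hz x hy0
  have hne : (x : ℂ) - z ≠ 0 := fun h => by
    have := congrArg Complex.im h
    simp at this
    linarith
  have hn : 0 < Complex.normSq ((x : ℂ) - z) := Complex.normSq_pos.2 hne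
  have e3 : ‖z - conj (x : ℂ)‖ ^ 2 = Complex.normSq ((x : ℂ) - z) := by
    rw [Complex.conj_ofReal, norm_sub_rev, Complex.normSq_eq_norm_sq]
  have e4 : (1 / ((x : ℂ) - z)).im = z.im / Complex.normSq ((x : ℂ) - z) := by
    rw [one_div, Complex.inv_im]
    simp
  rw [e3] at key
  rw [e4, ← mul_div_assoc, div_le_iff₀ hn]
  simp at key
  have : α * (α * z.im) ≤ α * ((f z).im * Complex.normSq ((x : ℂ) - z)) := by nlinarith
  exact le_of_mul_le_mul_left this hα

lemma tendsto_mul_simple_pole (x t : ℝ) (h : x ≠ t) (c : ℂ) :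
    Tendsto (fun y : ℝ => (y : ℂ) * (c * (1 / ((t : ℂ) - (x + y * Complex.I))))) (𝓝[>] 0)
      (𝓝 0) := by
  have hne : (t : ℂ) - x ≠ 0 := by
    rw [sub_ne_zero]
    exact_mod_cast h.symm
  have h1 : Tendsto (fun y : ℝ => (y : ℂ)) (𝓝[>] 0) (𝓝 0) := by
    simpa using tendsto_ofReal_mul_zero 1
  have h2 := h1.mul ((((tendsto_const_nhds (x := (1 : ℂ))).div
    ((tendsto_const_nhds (x := (t : ℂ))).sub (tendsto_vertical x)) hne).const_mul c))
  simpa using h2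

/-- Finitely many point masses may be subtracted from a Herglotz function. -/
lemma sum_poles_im_le {f : ℂ → ℂ} (hf : DifferentiableOn ℂ f upperHalf)
    (hpos : ∀ z ∈ upperHalf, 0 ≤ (f z).im) (α : ℝ → ℝ) (S : Finset ℝ)
    (hα : ∀ x ∈ S, 0 < α x)
    (hlim : ∀ x ∈ S, Tendsto (fun y : ℝ => (y : ℂ) * f (x + y * Complex.I)) (𝓝[>] 0)
      (𝓝 (α x * Complex.I))) :
    ∀ z ∈ upperHalf, 0 ≤ (f z - ∑ x ∈ S, (α x : ℂ) * (1 / ((x : ℂ) - z))).im := by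
  induction S using Finset.induction_on with
  | empty => simpa using hpos
  | insert t S ht ih =>
    have ih' := ih (fun x hx => hα x (Finset.mem_insert_of_mem hx))
      (fun x hx => hlim x (Finset.mem_insert_of_mem hx))
    have hd : DifferentiableOn ℂ (fun z => f z - ∑ x ∈ S, (α x : ℂ) * (1 / ((x : ℂ) - z)))
        upperHalf := by
      refine hf.sub (DifferentiableOn.fun_sum fun x _ => ?_)
      refine DifferentiableOn.const_mul (DifferentiableOn.div (by fun_prop) (by fun_prop) ?_) _
      intro z hz h
      have h1 := congrArg Complex.im h
      have h2 : 0 < z.im := hz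
      simp at h1
      linarith
    -- The poles already removed lie away from t, so they do not change the mass there and Julia's
    -- lemma applies to the remainder.
    have hl : Tendsto (fun y : ℝ => (y : ℂ) * ((f (t + y * Complex.I)) - ∑ x ∈ S, (α x : ℂ) *
        (1 / ((x : ℂ) - (t + y * Complex.I))))) (𝓝[>] 0) (𝓝 (α t * Complex.I)) := by
      have h1 := tendsto_finsetSum S (fun x hx => tendsto_mul_simple_pole t x
        (fun h => ht (h ▸ hx)) (α x))
      have h2 := (hlim t (Finset.mem_insert_self t S)).sub h1
      simpa [mul_sub, Finset.mul_sum] using h2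
    intro z hz
    have := julia hd ih' (hα t (Finset.mem_insert_self t S)) hl hz
    rw [Finset.sum_insert ht]
    have e : ((α t : ℂ) * (1 / ((t : ℂ) - z))).im = α t * (1 / ((t : ℂ) - z)).im :=
      Complex.im_ofReal_mul _ _
    simp only [Complex.sub_im, Complex.add_im] at this ⊢
    rw [e]
    linarith

/-! ### Monotonicity on the real line -/

/-- Im f vanishes at x and is nonnegative above it; its upward derivative there is Re f'(x) by
Cauchy-Riemann. -/
lemma re_deriv_nonneg {f : ℂ → ℂ} (hpos : ∀ z ∈ upperHalf, 0 ≤ (f z).im) {x : ℝ}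
    (hd : DifferentiableAt ℂ f x) (hx : (f x).im = 0) : 0 ≤ (deriv f x).re := by
  have h1 : HasDerivAt (fun y : ℝ => f (x + y * Complex.I)) (deriv f x * Complex.I) 0 := by
    have h2 : HasDerivAt (fun y : ℝ => (x : ℂ) + y * Complex.I) Complex.I 0 := by
      simpa using ((Complex.ofRealCLM.hasDerivAt (x := (0 : ℝ))).mul_const Complex.I).const_add
        (x : ℂ)
    have h3 : HasDerivAt f (deriv f x) ((x : ℂ) + (0 : ℝ) * Complex.I) := by
      simpa using hd.hasDerivAt
    exact h3.comp (0 : ℝ) h2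
  have h4 : HasDerivAt (fun y : ℝ => (f (x + y * Complex.I)).im) (deriv f x).re 0 := by
    rw [show (deriv f x).re = Complex.imCLM (deriv f x * Complex.I) by simp]
    exact Complex.imCLM.hasFDerivAt.comp_hasDerivAt (0 : ℝ) h1
  have h5 := h4.tendsto_slope_zero_right
  refine ge_of_tendsto h5 ?_
  filter_upwards [self_mem_nhdsWithin] with y hy
  have hy : 0 < y := hy
  have : 0 ≤ (f (x + y * Complex.I)).im := hpos _ (by simpa [upperHalf] using hy)
  simp only [zero_add, Complex.ofReal_zero, zero_mul, add_zero, hx, sub_zero, smul_eq_mul]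
  positivity

lemma monotoneOn_re {f : ℂ → ℂ} (hpos : ∀ z ∈ upperHalf, 0 ≤ (f z).im) {a b : ℝ}
    (hd : ∀ x ∈ Ioo a b, DifferentiableAt ℂ f x) (hx : ∀ x ∈ Ioo a b, (f (x : ℂ)).im = 0) :
    MonotoneOn (fun x : ℝ => (f x).re) (Ioo a b) := by
  have h : ∀ x ∈ Ioo a b, HasDerivAt (fun x : ℝ => (f x).re) (deriv f x).re x := fun x hx' =>
    (hd x hx').hasDerivAt.real_of_complex
  refine monotoneOn_of_deriv_nonneg (convex_Ioo a b)
    (fun x hx' => (h x hx').continuousAt.continuousWithinAt)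
    (fun x hx' => ?_) (fun x hx' => ?_)
  · rw [interior_Ioo] at hx'
    exact (h x hx').differentiableAt.differentiableWithinAt
  · rw [interior_Ioo] at hx'
    rw [(h x hx').deriv]
    exact re_deriv_nonneg hpos (hd x hx') (hx x hx')

/-! ### Boundary behaviour of meromorphic inner functions -/

/-- A pole at x would make |Θ| blow up along the vertical above x, against boundedness; normal form
rules out a removable singularity. -/
lemma IsMIF.analyticAt_real {Θ : ℂ → ℂ} (h : IsMIF Θ) (x : ℝ) : AnalyticAt ℂ Θ x := by
  have nf : MeromorphicNFAt Θ x := h.meromorphic (mem_univ _)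
  rw [← nf.meromorphicOrderAt_nonneg_iff_analyticAt]
  by_contra hlt
  rw [not_le, ← tendsto_cobounded_iff_meromorphicOrderAt_neg nf.meromorphicAt] at hlt
  obtain ⟨C, hC⟩ := h.inner.bounded
  have hv : Tendsto (fun y : ℝ => (x : ℂ) + y * Complex.I) (𝓝[>] 0) (𝓝[≠] (x : ℂ)) := by
    refine tendsto_nhdsWithin_iff.2 ⟨tendsto_vertical x, ?_⟩
    filter_upwards [self_mem_nhdsWithin] with y hy
    have hy : 0 < y := hy
    simpa using hy.ne'
  have h1 := tendsto_norm_atTop_iff_cobounded.2 (hlt.comp hv)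
  obtain ⟨y, hy1, hy2⟩ := ((h1.eventually (eventually_gt_atTop C)).and
    self_mem_nhdsWithin).exists
  have hy2 : 0 < y := hy2
  exact absurd (hC _ (by simpa [upperHalf] using hy2)) (not_le.2 hy1)

lemma IsMIF.analyticAt {Θ : ℂ → ℂ} (h : IsMIF Θ) {z : ℂ} (hz : 0 ≤ z.im) :
    AnalyticAt ℂ Θ z := by
  rcases hz.eq_or_lt with h0 | h0
  · have : z = (z.re : ℂ) := Complex.ext (by simp) (by simp [← h0])
    rw [this]
    exact h.analyticAt_real _
  · exact h.inner.analytic z h0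

lemma IsMIF.norm_real {Θ : ℂ → ℂ} (h : IsMIF Θ) (x : ℝ) : ‖Θ x‖ = 1 := by
  have hc : Continuous fun x : ℝ => ‖Θ x‖ := by
    refine continuous_iff_continuousAt.2 fun t => ContinuousAt.norm ?_
    exact ContinuousAt.comp (f := fun s : ℝ => (s : ℂ)) (h.analyticAt_real t).continuousAt
      Complex.continuous_ofReal.continuousAt
  have hae : (fun x : ℝ => ‖Θ x‖) =ᵐ[volume] fun _ => (1 : ℝ) := by
    filter_upwards [h.inner.unimodular] with t ht
    exact tendsto_nhds_unique
      (((h.analyticAt_real t).continuousAt.tendsto.comp (tendsto_vertical t)).norm) ht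
  exact congrFun ((hc.ae_eq_iff_eq _ continuous_const).1 hae) x

/-- Inner functions are only assumed bounded; Phragmén-Lindelöf, after a rotation to the right
half-plane, improves the bound to the boundary value 1. -/
lemma IsMIF.norm_le_one {Θ : ℂ → ℂ} (h : IsMIF Θ) {z : ℂ} (hz : 0 ≤ z.im) : ‖Θ z‖ ≤ 1 := by
  set g : ℂ → ℂ := fun w => Θ (Complex.I * w) with hg
  have hd : DiffContOnCl ℂ g {w | 0 < w.re} := by
    refine DifferentiableOn.diffContOnCl fun w hw => ?_
    rw [Complex.closure_setOfPred_lt_re] at hw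
    have hw : 0 ≤ w.re := hw
    refine DifferentiableAt.differentiableWithinAt ?_
    exact DifferentiableAt.comp w (h.analyticAt (by simpa using hw)).differentiableAt
      (by fun_prop)
  obtain ⟨C, hC⟩ := h.inner.bounded
  have hb : ∀ w : ℂ, 0 < w.re → ‖g w‖ ≤ C := fun w hw => hC _ (by simpa [upperHalf] using hw)
  have key := PhragmenLindelof.right_half_plane_of_bounded_on_real (C := 1) hd
    ⟨0, by norm_num, 0, ?_⟩ ?_ (fun x => ?_) (z := -Complex.I * z) (by simpa using hz)
  · simpa [hg, ← mul_assoc] using key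
  · refine Asymptotics.IsBigO.of_bound C ?_
    refine eventually_inf_principal.2 (Eventually.of_forall fun w hw => ?_)
    simpa using hb w hw
  · refine ⟨C, ?_⟩
    rw [eventually_map]
    filter_upwards [eventually_gt_atTop 0] with x hx
    exact hb x (by simpa using hx)
  · have : Complex.I * (x * Complex.I) = ((-x : ℝ) : ℂ) := by
      push_cast
      linear_combination (x : ℂ) * Complex.I_mul_I
    simp only [hg, this, h.norm_real, le_refl]

/-- Maximum modulus: an interior value 1 would force Θ = 1 on the closed half-plane. A real point
off the spectrum serves from here on to exclude this constant, for which the Herglotz function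
degenerates. -/
lemma IsMIF.ne_one {Θ : ℂ → ℂ} (h : IsMIF Θ) {x : ℝ} (hx : Θ x ≠ 1) {z : ℂ}
    (hz : z ∈ upperHalf) : Θ z ≠ 1 := by
  intro h1
  have hpre : IsPreconnected upperHalf := (convex_halfSpace_im_gt 0).isPreconnected
  have hop : IsOpen upperHalf := isOpen_lt continuous_const Complex.continuous_im
  have hcl : closure upperHalf = {z : ℂ | 0 ≤ z.im} := Complex.closure_setOfPred_lt_im 0
  have hd : DiffContOnCl ℂ Θ upperHalf := by
    refine DifferentiableOn.diffContOnCl fun w hw => ?_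
    rw [hcl] at hw
    exact (h.analyticAt hw).differentiableAt.differentiableWithinAt
  have := Complex.eqOn_closure_of_isPreconnected_of_isMaxOn_norm hpre hop hd hz
    (fun w hw => by
      have hw : 0 < w.im := hw
      simpa [h1] using h.norm_le_one hw.le) (x := (x : ℂ)) (by simp [hcl])
  exact hx (this.trans h1)

/-! ### The Herglotz function and its point masses -/

/-- The Herglotz function of `Θ`, with poles at the spectrum. -/
noncomputable def herglotz (Θ : ℂ → ℂ) (z : ℂ) : ℂ := Complex.I * (1 + Θ z) / (1 - Θ z)

lemma herglotz_im (Θ : ℂ → ℂ) (z : ℂ) :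
    (herglotz Θ z).im = (1 - ‖Θ z‖ ^ 2) / Complex.normSq (1 - Θ z) := by
  rw [herglotz, Complex.div_im, ← Complex.normSq_eq_norm_sq, Complex.normSq_apply (Θ z)]
  simp
  ring

lemma IsMIF.herglotz_im_nonneg {Θ : ℂ → ℂ} (h : IsMIF Θ) :
    ∀ z ∈ upperHalf, 0 ≤ (herglotz Θ z).im := by
  intro z hz
  have hz : 0 < z.im := hz
  rw [herglotz_im]
  refine div_nonneg ?_ (Complex.normSq_nonneg _)
  nlinarith [h.norm_le_one hz.le, norm_nonneg (Θ z)]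

lemma IsMIF.herglotz_im_real {Θ : ℂ → ℂ} (h : IsMIF Θ) (x : ℝ) :
    (herglotz Θ x).im = 0 := by
  rw [herglotz_im, h.norm_real]
  simp

lemma IsMIF.hasDerivAt_herglotz {Θ : ℂ → ℂ} (h : IsMIF Θ) {z : ℂ} (hz : 0 ≤ z.im)
    (h1 : Θ z ≠ 1) :
    HasDerivAt (herglotz Θ) (2 * Complex.I * deriv Θ z / (1 - Θ z) ^ 2) z := by
  have hd := (h.analyticAt hz).differentiableAt.hasDerivAt
  have := ((hd.const_add 1).const_mul Complex.I).div (hd.const_sub 1) (sub_ne_zero.2 h1.symm)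
  refine HasDerivAt.congr_deriv (f := herglotz Θ) this ?_
  congr 1
  ring

lemma IsMIF.differentiableOn_herglotz {Θ : ℂ → ℂ} (h : IsMIF Θ) {x : ℝ} (hx : Θ x ≠ 1) :
    DifferentiableOn ℂ (herglotz Θ) upperHalf := fun _ hz =>
  (h.hasDerivAt_herglotz (le_of_lt hz) (h.ne_one hx hz)).differentiableAt.differentiableWithinAt

/-- On the real line the derivative of `Θ` at a spectral point is `i` times a nonnegative real. -/
lemma IsMIF.deriv_spec {Θ : ℂ → ℂ} (h : IsMIF Θ) {x : ℝ} (hx : Θ x = 1) :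
    ∃ s : ℝ, 0 ≤ s ∧ deriv Θ x = s * Complex.I := by
  have hd := (h.analyticAt_real x).differentiableAt.hasDerivAt
  have hre : (deriv Θ x).re = 0 := by
    have h1 : HasDerivAt (fun t : ℝ => Θ t) (deriv Θ x) x := hd.comp_ofReal
    have h2 := h1.norm_sq
    have h3 : HasDerivAt (fun t : ℝ => ‖Θ t‖ ^ 2) 0 x := by
      simpa [h.norm_real] using hasDerivAt_const x (1 : ℝ)
    have h4 := h2.unique h3
    simpa [hx] using h4
  -- Im of i(1 - Θ) is 1 - Re Θ ≥ 0, with equality at x.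
  have him : 0 ≤ (deriv (fun z => Complex.I * (1 - Θ z)) x).re := by
    refine re_deriv_nonneg (fun z hz => ?_) ((hd.const_sub 1).const_mul _).differentiableAt
      (by simp [hx])
    have hz : 0 < z.im := hz
    have := (Complex.re_le_norm _).trans (h.norm_le_one hz.le)
    simpa using this
  rw [((hd.const_sub 1).const_mul Complex.I).deriv] at him
  exact ⟨(deriv Θ x).im, by simpa using him, Complex.ext (by simp [hre]) (by simp)⟩

/-- A function with nonnegative imaginary part has at most simple poles on the real line. -/
lemma eventually_norm_mul_le {f : ℂ → ℂ} (hf : DifferentiableOn ℂ f upperHalf)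
    (hpos : ∀ z ∈ upperHalf, 0 ≤ (f z).im) (x : ℝ) :
    ∃ B : ℝ, ∀ᶠ y : ℝ in 𝓝[>] 0, ‖(y : ℂ) * f (x + y * Complex.I)‖ ≤ B := by
  have hc : Continuous (starRingEnd ℂ) := Complex.continuous_conj
  have hI : 0 < Complex.I.im := by simp
  set K : ℝ := (f Complex.I).im * (‖Complex.I - starRingEnd ℂ (x : ℂ)‖ ^ 2 + 1) with hK
  have hfI : 0 ≤ (f Complex.I).im := hpos _ hI
  have hK0 : 0 ≤ K := by positivity
  -- Schwarz-Pick against the point i gives (‖u‖ - 1)² ≤ K‖u‖ for u = y f(x + iy), which fails once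
  -- ‖u‖ > K + 3.
  refine ⟨K + 3, ?_⟩
  have h1 : ∀ᶠ y : ℝ in 𝓝[>] 0, ‖(y : ℂ) * f Complex.I‖ < 1 :=
    (tendsto_ofReal_mul_zero (f Complex.I)).norm.eventually_lt_const (by simp)
  have h2 : ∀ᶠ y : ℝ in 𝓝[>] 0, ‖Complex.I - starRingEnd ℂ (x + y * Complex.I)‖ ^ 2 <
      ‖Complex.I - starRingEnd ℂ (x : ℂ)‖ ^ 2 + 1 :=
    ((tendsto_const_nhds.sub ((hc.tendsto _).comp (tendsto_vertical x))).norm.pow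
      2).eventually_lt_const (lt_add_one _)
  filter_upwards [h1, h2, self_mem_nhdsWithin] with y hy1 hy2 hy0
  have key := schwarz_pick_vertical hf hpos hI x hy0
  set u := (y : ℂ) * f (x + y * Complex.I) with hu
  by_contra! hlt
  have e1 : ‖u‖ - 1 ≤ ‖(y : ℂ) * f Complex.I - starRingEnd ℂ u‖ := by
    have := norm_sub_norm_le (starRingEnd ℂ u) ((y : ℂ) * f Complex.I)
    rw [norm_sub_rev, RCLike.norm_conj] at this
    linarith
  have e2 : (‖u‖ - 1) ^ 2 ≤ ‖(y : ℂ) * f Complex.I - starRingEnd ℂ u‖ ^ 2 :=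
    pow_le_pow_left₀ (by linarith) e1 2
  have e3 : (f Complex.I).im * u.im * ‖Complex.I - starRingEnd ℂ (x + y * Complex.I)‖ ^ 2
      ≤ K * ‖u‖ := by
    calc _ ≤ (f Complex.I).im * ‖u‖ * (‖Complex.I - starRingEnd ℂ (x : ℂ)‖ ^ 2 + 1) := by
          gcongr
          exact (le_abs_self _).trans (Complex.abs_im_le_norm u)
      _ = K * ‖u‖ := by rw [hK]; ring
  simp only [Complex.I_im, mul_one] at key
  nlinarith

lemma IsMIF.tendsto_slope_vertical {Θ : ℂ → ℂ} (h : IsMIF Θ) {x s : ℝ} (hx : Θ x = 1)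
    (hs : deriv Θ x = s * Complex.I) :
    Tendsto (fun y : ℝ => (1 - Θ (x + y * Complex.I)) / y) (𝓝[>] 0) (𝓝 (s : ℂ)) := by
  have hd := (h.analyticAt_real x).differentiableAt.hasDerivAt
  have h1 : HasDerivAt (fun y : ℝ => Θ (x + y * Complex.I)) (deriv Θ x * Complex.I) 0 := by
    have h2 : HasDerivAt (fun y : ℝ => (x : ℂ) + y * Complex.I) Complex.I 0 := by
      simpa using ((Complex.ofRealCLM.hasDerivAt (x := (0 : ℝ))).mul_const Complex.I).const_add
        (x : ℂ)
    have h3 : HasDerivAt Θ (deriv Θ x) ((x : ℂ) + (0 : ℝ) * Complex.I) := by simpa using hd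
    exact h3.comp (0 : ℝ) h2
  have h2 := h1.tendsto_slope_zero_right.neg
  have e : -(deriv Θ x * Complex.I) = s := by
    rw [hs]
    linear_combination -(s : ℂ) * Complex.I_mul_I
  rw [e] at h2
  refine h2.congr fun y => ?_
  simp only [hx, zero_add, Complex.ofReal_zero, zero_mul, add_zero, Complex.real_smul,
    Complex.ofReal_inv]
  ring

lemma one_sub_mul_herglotz {Θ : ℂ → ℂ} {z : ℂ} (hz : Θ z ≠ 1) :
    (1 - Θ z) * herglotz Θ z = Complex.I * (1 + Θ z) := by
  have : 1 - Θ z ≠ 0 := sub_ne_zero.2 hz.symm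
  rw [herglotz]
  field_simp

/-- If Θ'(x) = 0, then in i(1+Θ) = ((1-Θ)/y)·(y m) the first factor tends to 0 and the second stays
bounded, while the left side tends to 2i. -/
lemma IsMIF.deriv_spec_pos {Θ : ℂ → ℂ} (h : IsMIF Θ) {t : ℝ} (ht : Θ t ≠ 1) {x : ℝ}
    (hx : Θ x = 1) : ∃ s : ℝ, 0 < s ∧ deriv Θ x = s * Complex.I := by
  obtain ⟨s, hs0, hs⟩ := h.deriv_spec hx
  refine ⟨s, lt_of_le_of_ne hs0 fun hs1 => ?_, hs⟩
  obtain ⟨B, hB⟩ := eventually_norm_mul_le (h.differentiableOn_herglotz ht)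
    h.herglotz_im_nonneg x
  have hΘ := (h.analyticAt_real x).continuousAt.tendsto.comp (tendsto_vertical x)
  have h1 : ‖Complex.I * (1 + Θ x)‖ ≤ ‖(s : ℂ)‖ * B := by
    refine le_of_tendsto_of_tendsto ((hΘ.const_add 1).const_mul Complex.I).norm
      ((h.tendsto_slope_vertical hx hs).norm.mul_const B) ?_
    filter_upwards [hB, self_mem_nhdsWithin] with y hy hy0
    have hy0 : 0 < y := hy0
    have hy1 : (y : ℂ) ≠ 0 := by exact_mod_cast hy0.ne'
    have e := one_sub_mul_herglotz (h.ne_one ht (z := x + y * Complex.I)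
      (by simpa [upperHalf] using hy0))
    simp only [Function.comp]
    rw [← e]
    calc _ = ‖(1 - Θ (x + y * Complex.I)) / y‖ * ‖(y : ℂ) * herglotz Θ (x + y * Complex.I)‖ := by
          rw [← norm_mul]
          congr 1
          field_simp
      _ ≤ _ := by gcongr
  rw [hx, ← hs1] at h1
  norm_num at h1

/-- The point mass of `Θ` at a spectral point. -/
noncomputable def mass (Θ : ℂ → ℂ) (x : ℝ) : ℝ := 2 / ‖deriv Θ x‖

lemma IsMIF.mass_pos {Θ : ℂ → ℂ} (h : IsMIF Θ) {t : ℝ} (ht : Θ t ≠ 1) {x : ℝ}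
    (hx : Θ x = 1) : 0 < mass Θ x := by
  obtain ⟨s, hs0, hs⟩ := h.deriv_spec_pos ht hx
  rw [mass, hs]
  have : (s : ℂ) ≠ 0 := by exact_mod_cast hs0.ne'
  have : 0 < ‖(s : ℂ) * Complex.I‖ := by simpa using this
  positivity

lemma IsMIF.tendsto_mass {Θ : ℂ → ℂ} (h : IsMIF Θ) {t : ℝ} (ht : Θ t ≠ 1) {x : ℝ}
    (hx : Θ x = 1) : Tendsto (fun y : ℝ => (y : ℂ) * herglotz Θ (x + y * Complex.I)) (𝓝[>] 0)
      (𝓝 (mass Θ x * Complex.I)) := by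
  obtain ⟨s, hs0, hs⟩ := h.deriv_spec_pos ht hx
  have hsne : (s : ℂ) ≠ 0 := by exact_mod_cast hs0.ne'
  have hΘ := (h.analyticAt_real x).continuousAt.tendsto.comp (tendsto_vertical x)
  have h1 := ((hΘ.const_add 1).const_mul Complex.I).div (h.tendsto_slope_vertical hx hs) hsne
  have e : Complex.I * (1 + Θ x) / s = mass Θ x * Complex.I := by
    rw [mass, hs, hx]
    simp [abs_of_pos hs0]
    ring
  rw [e] at h1
  refine h1.congr' ?_
  filter_upwards [self_mem_nhdsWithin] with y hy0
  have hy0 : 0 < y := hy0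
  have hy1 : (y : ℂ) ≠ 0 := by exact_mod_cast hy0.ne'
  have hne := sub_ne_zero.2 (h.ne_one ht (z := x + y * Complex.I)
      (by simpa [upperHalf] using hy0)).symm
  simp only [Function.comp, herglotz, Pi.div_apply]
  field_simp

/-- The regular part of the Herglotz function at a spectral point has a limit. -/
lemma IsMIF.tendsto_regular_part {Θ : ℂ → ℂ} (h : IsMIF Θ) {t : ℝ} (ht : Θ t ≠ 1) {x : ℝ}
    (hx : Θ x = 1) : ∃ l : ℝ, Tendsto (fun u : ℝ => (herglotz Θ u).re - mass Θ x / (x - u))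
      (𝓝[≠] x) (𝓝 l) := by
  obtain ⟨s, hs0, hs⟩ := h.deriv_spec_pos ht hx
  have hsne : (s : ℂ) ≠ 0 := by exact_mod_cast hs0.ne'
  have hG : DifferentiableAt ℂ (dslope Θ x) x := by
    obtain ⟨p, hp⟩ := h.analyticAt_real x
    exact hp.has_fpower_series_dslope_fslope.analyticAt.differentiableAt
  have hG0 : dslope Θ x x = s * Complex.I := by rw [dslope_same, hs]
  -- Dividing the zero out of 1 - Θ gives m = F/(x - z) with F differentiable at x and F(x) the
  -- mass; the regular part then tends to -Re F'(x).
  set F : ℂ → ℂ := fun z => Complex.I * (1 + Θ z) / dslope Θ x z with hF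
  have hFd : DifferentiableAt ℂ F x := by
    refine DifferentiableAt.div ?_ hG (by rw [hG0]; exact mul_ne_zero hsne Complex.I_ne_zero)
    exact ((h.analyticAt_real x).differentiableAt.const_add 1).const_mul _
  have hF0 : F x = mass Θ x := by
    simp only [hF]
    rw [hG0, mass, hs, hx]
    simp [abs_of_pos hs0]
    field_simp
    norm_num
  refine ⟨-(deriv F x).re, ?_⟩
  have h1 := hasDerivAt_iff_tendsto_slope.1 hFd.hasDerivAt.real_of_complex
  refine h1.neg.congr' ?_
  filter_upwards [self_mem_nhdsWithin] with u hu
  have hu : u ≠ x := hu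
  have hu1 : (u : ℂ) - x ≠ 0 := by
    rw [sub_ne_zero]
    exact_mod_cast hu
  have hm : herglotz Θ u = F u / (((x - u : ℝ)) : ℂ) := by
    simp only [hF, herglotz]
    rw [dslope_of_ne _ (sub_ne_zero.1 hu1), slope_def_field, hx]
    push_cast
    rw [div_div]
    congr 1
    have : (x : ℂ) - u = -(u - x) := by ring
    rw [this, mul_neg, div_mul_cancel₀ _ hu1]
    ring
  rw [hm, Complex.div_ofReal_re, slope_def_field, hF0, Complex.ofReal_re]
  rw [← sub_div, ← neg_sub x u, div_neg, neg_neg]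

/-! ### Estimates from a bounded derivative -/

lemma IsMIF.le_mass {Θ : ℂ → ℂ} (h : IsMIF Θ) {t : ℝ} (ht : Θ t ≠ 1) {C : ℝ}
    (hC : ∀ x : ℝ, ‖deriv Θ x‖ ≤ C) {x : ℝ} (hx : Θ x = 1) : 2 / C ≤ mass Θ x := by
  obtain ⟨s, hs0, hs⟩ := h.deriv_spec_pos ht hx
  have : (s : ℂ) ≠ 0 := by exact_mod_cast hs0.ne'
  have h1 : 0 < ‖deriv Θ x‖ := by
    rw [hs]
    simpa using this
  rw [mass]
  gcongr
  exact hC x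

lemma IsMIF.sub_poles_im_nonneg {Θ : ℂ → ℂ} (h : IsMIF Θ) {t : ℝ} (ht : Θ t ≠ 1)
    {S : Finset ℝ} (hS : ∀ x ∈ S, Θ (x : ℂ) = 1) :
    ∀ z ∈ upperHalf,
      0 ≤ (herglotz Θ z - ∑ x ∈ S, (mass Θ x : ℂ) * (1 / ((x : ℂ) - z))).im :=
  sum_poles_im_le (h.differentiableOn_herglotz ht) h.herglotz_im_nonneg (mass Θ) S
    (fun x hx => h.mass_pos ht (hS x hx)) (fun x hx => h.tendsto_mass ht (hS x hx))

lemma real_sub_ne_zero {Θ : ℂ → ℂ} {x u : ℝ} (hx : Θ x = 1) (hu : Θ u ≠ 1) :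
    (x : ℂ) - u ≠ 0 := by
  rw [sub_ne_zero]
  intro e
  exact hu (e ▸ hx)

lemma IsMIF.hasDerivAt_sub_poles {Θ : ℂ → ℂ} (h : IsMIF Θ)
    {S : Finset ℝ} (hS : ∀ x ∈ S, Θ (x : ℂ) = 1) {u : ℝ} (hu : Θ u ≠ 1) :
    HasDerivAt (fun z => herglotz Θ z - ∑ x ∈ S, (mass Θ x : ℂ) * (1 / ((x : ℂ) - z)))
      (2 * Complex.I * deriv Θ u / (1 - Θ u) ^ 2 -
        ∑ x ∈ S, (mass Θ x : ℂ) * (1 / ((x : ℂ) - u) ^ 2)) u := by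
  refine (h.hasDerivAt_herglotz (by simp) hu).sub (HasDerivAt.fun_sum fun x hx => ?_)
  refine HasDerivAt.const_mul _ ?_
  have := ((hasDerivAt_id (u : ℂ)).const_sub (x : ℂ)).inv (real_sub_ne_zero (hS x hx) hu)
  simp only [one_div]
  exact this.congr_deriv (by simp)

lemma IsMIF.sub_poles_im_real {Θ : ℂ → ℂ} (h : IsMIF Θ) (S : Finset ℝ) (u : ℝ) :
    (herglotz Θ u - ∑ x ∈ S, (mass Θ x : ℂ) * (1 / ((x : ℂ) - u))).im = 0 := by
  rw [Complex.sub_im, h.herglotz_im_real, Complex.im_sum, Finset.sum_eq_zero, sub_zero]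
  intro x _
  rw [← Complex.ofReal_sub, ← Complex.ofReal_one, ← Complex.ofReal_div, ← Complex.ofReal_mul,
    Complex.ofReal_im]

lemma sub_poles_re (Θ : ℂ → ℂ) (S : Finset ℝ) (u : ℝ) :
    (herglotz Θ u - ∑ x ∈ S, (mass Θ x : ℂ) * (1 / ((x : ℂ) - u))).re =
      (herglotz Θ u).re - ∑ x ∈ S, mass Θ x * (1 / (x - u)) := by
  rw [Complex.sub_re, Complex.re_sum]
  congr 1
  refine Finset.sum_congr rfl fun x _ => ?_
  rw [← Complex.ofReal_sub, ← Complex.ofReal_one, ← Complex.ofReal_div, ← Complex.ofReal_mul,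
    Complex.ofReal_re]

lemma IsMIF.monotoneOn_sub_poles {Θ : ℂ → ℂ} (h : IsMIF Θ) {t : ℝ} (ht : Θ t ≠ 1)
    {S : Finset ℝ} (hS : ∀ x ∈ S, Θ (x : ℂ) = 1) {a b : ℝ}
    (hab : ∀ u ∈ Ioo a b, Θ (u : ℂ) ≠ 1) :
    MonotoneOn (fun u : ℝ => (herglotz Θ u).re - ∑ x ∈ S, mass Θ x * (1 / (x - u)))
      (Ioo a b) := by
  have := monotoneOn_re (h.sub_poles_im_nonneg ht hS)
    (fun u hu => (h.hasDerivAt_sub_poles hS (hab u hu)).differentiableAt)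
    (fun u _ => h.sub_poles_im_real S u)
  simpa only [sub_poles_re] using this

/-- A point mass is controlled by the derivative of `Θ` at a nearby point where `Θ = -1`. -/
lemma IsMIF.mass_le {Θ : ℂ → ℂ} (h : IsMIF Θ) {C : ℝ} (hC : ∀ x : ℝ, ‖deriv Θ x‖ ≤ C)
    {p μ : ℝ} (hp : Θ p = 1) (hμ : Θ μ = -1) (hpμ : |p - μ| ≤ 1) : mass Θ p ≤ C / 2 := by
  have hμ1 : Θ μ ≠ 1 := by
    rw [hμ]
    norm_num
  have hne := real_sub_ne_zero hp hμ1
  have hne' : p - μ ≠ 0 := by exact_mod_cast hne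
  have hS : ∀ x ∈ ({p} : Finset ℝ), Θ (x : ℂ) = 1 := by simpa using hp
  have hd := h.hasDerivAt_sub_poles hS hμ1
  have h1 := re_deriv_nonneg (h.sub_poles_im_nonneg hμ1 hS) hd.differentiableAt
    (h.sub_poles_im_real _ μ)
  rw [hd.deriv, Complex.sub_re, Finset.sum_singleton] at h1
  have e : ((mass Θ p : ℂ) * (1 / ((p : ℂ) - μ) ^ 2)).re = mass Θ p / (p - μ) ^ 2 := by
    rw [← Complex.ofReal_sub, ← Complex.ofReal_pow, ← Complex.ofReal_one, ← Complex.ofReal_div,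
      ← Complex.ofReal_mul, Complex.ofReal_re, mul_one_div]
  -- Since (1 - Θ(μ))² = 4, m'(μ) = iΘ'(μ)/2. It also dominates mass/(p - μ)², which is at least the
  -- mass.
  have h2 : (2 * Complex.I * deriv Θ μ / (1 - Θ μ) ^ 2).re ≤ C / 2 := by
    refine (Complex.re_le_norm _).trans ?_
    rw [hμ]
    norm_num
    linarith [hC μ]
  have hsq : (p - μ) ^ 2 ≤ 1 := (sq_le_one_iff_abs_le_one _).2 hpμ
  have hm := h.mass_pos hμ1 hp
  have h3 : mass Θ p ≤ mass Θ p / (p - μ) ^ 2 := by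
    rw [le_div_iff₀ (by positivity)]
    nlinarith
  rw [e] at h1
  linarith

/-- Mean value inequality: Θ moves from -1 to 1, a distance 2. -/
lemma IsMIF.two_le_mul_abs_sub {Θ : ℂ → ℂ} (h : IsMIF Θ) {C : ℝ}
    (hC : ∀ x : ℝ, ‖deriv Θ x‖ ≤ C) {p μ : ℝ} (hp : Θ p = 1) (hμ : Θ μ = -1) :
    2 ≤ C * |p - μ| := by
  have hd : ∀ x : ℝ, HasDerivAt (fun x : ℝ => Θ x) (deriv Θ x) x := fun x =>
    (h.analyticAt_real x).differentiableAt.hasDerivAt.comp_ofReal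
  have := Convex.norm_image_sub_le_of_norm_hasDerivWithin_le (s := univ) (x := μ) (y := p)
    (fun x _ => (hd x).hasDerivWithinAt) (fun x _ => hC x) convex_univ (mem_univ _) (mem_univ _)
  rw [hp, hμ] at this
  norm_num at this
  exact this

/-- After removing the pole at `p`, the Herglotz function increases across `p`. -/
lemma IsMIF.le_across {Θ : ℂ → ℂ} (h : IsMIF Θ) {a p b x y : ℝ} (hp : Θ p = 1)
    (hap : ∀ u ∈ Ioo a p, Θ (u : ℂ) ≠ 1) (hpb : ∀ u ∈ Ioo p b, Θ (u : ℂ) ≠ 1)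
    (hx : x ∈ Ioo a p) (hy : y ∈ Ioo p b) :
    (herglotz Θ x).re - mass Θ p / (p - x) ≤ (herglotz Θ y).re - mass Θ p / (p - y) := by
  have ht := hap x hx
  have hS : ∀ x ∈ ({p} : Finset ℝ), Θ (x : ℂ) = 1 := by simpa using hp
  obtain ⟨l, hl⟩ := h.tendsto_regular_part ht hp
  have m1 := h.monotoneOn_sub_poles ht hS hap
  have m2 := h.monotoneOn_sub_poles ht hS hpb
  simp only [Finset.sum_singleton, mul_one_div] at m1 m2
  have h1 := ge_of_tendsto (hl.mono_left (nhdsLT_le_nhdsNE p)) <| by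
    filter_upwards [Ioo_mem_nhdsLT hx.2] with u hu
    exact m1 hx ⟨hx.1.trans hu.1, hu.2⟩ hu.1.le
  have h2 := le_of_tendsto (hl.mono_left (nhdsGT_le_nhdsNE p)) <| by
    filter_upwards [Ioo_mem_nhdsGT hy.1] with u hu
    exact m2 ⟨hu.1, hu.2.trans hy.2⟩ hy hu.2.le
  exact h1.trans h2

/-- Between consecutive spectral points there is a point where `Θ = -1`. -/
lemma IsMIF.exists_eq_neg_one {Θ : ℂ → ℂ} (h : IsMIF Θ) {p q : ℝ} (hpq : p < q) (hp : Θ p = 1)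
    (hq : Θ q = 1) (hfree : ∀ u ∈ Ioo p q, Θ (u : ℂ) ≠ 1) :
    ∃ μ ∈ Ioo p q, Θ (μ : ℂ) = -1 ∧ (herglotz Θ μ).re = 0 := by
  have ht := hfree ((p + q) / 2) ⟨by linarith, by linarith⟩
  obtain ⟨l, hl⟩ := h.tendsto_regular_part ht hp
  obtain ⟨r, hr⟩ := h.tendsto_regular_part ht hq
  have hbot : Tendsto (fun u : ℝ => (herglotz Θ u).re) (𝓝[>] p) atBot := by
    have h1 : Tendsto (fun u : ℝ => mass Θ p / (p - u)) (𝓝[>] p) atBot := by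
      have h2 : Tendsto (fun u : ℝ => p - u) (𝓝[>] p) (𝓝[<] 0) :=
        tendsto_nhdsWithin_iff.2 ⟨(Continuous.tendsto' (by fun_prop) p 0 (by simp)).mono_left
          nhdsWithin_le_nhds, by filter_upwards [self_mem_nhdsWithin] with u hu; simpa using hu⟩
      exact (tendsto_inv_nhdsLT_zero.comp h2).const_mul_atBot (h.mass_pos ht hp)
    refine ((hl.mono_left (nhdsGT_le_nhdsNE p)).add_atBot h1).congr fun u => ?_
    ring
  have htop : Tendsto (fun u : ℝ => (herglotz Θ u).re) (𝓝[<] q) atTop := by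
    have h1 : Tendsto (fun u : ℝ => mass Θ q / (q - u)) (𝓝[<] q) atTop := by
      have h2 : Tendsto (fun u : ℝ => q - u) (𝓝[<] q) (𝓝[>] 0) :=
        tendsto_nhdsWithin_iff.2 ⟨(Continuous.tendsto' (by fun_prop) q 0 (by simp)).mono_left
          nhdsWithin_le_nhds, by filter_upwards [self_mem_nhdsWithin] with u hu; simpa using hu⟩
      exact (tendsto_inv_nhdsGT_zero.comp h2).const_mul_atTop (h.mass_pos ht hq)
    refine ((hr.mono_left (nhdsLT_le_nhdsNE q)).add_atTop h1).congr fun u => ?_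
    ring
  have hc : ContinuousOn (fun u : ℝ => (herglotz Θ u).re) (Ioo p q) := fun u hu =>
    (h.hasDerivAt_herglotz (by simp) (hfree u hu)).real_of_complex.continuousAt.continuousWithinAt
  -- m runs from -∞ to +∞ across the interval, and its zeros are the points where Θ = -1.
  have := isPreconnected_Ioo.intermediate_value_Iii (le_principal_iff.2 (Ioo_mem_nhdsGT hpq))
    (le_principal_iff.2 (Ioo_mem_nhdsLT hpq)) hc hbot htop
  obtain ⟨μ, hμ, hμ0⟩ := this (mem_univ 0)
  have hμ0 : (herglotz Θ μ).re = 0 := hμ0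
  refine ⟨μ, hμ, ?_, hμ0⟩
  have h0 : herglotz Θ μ = 0 := Complex.ext hμ0 (h.herglotz_im_real μ)
  have h1 := one_sub_mul_herglotz (hfree μ hμ)
  rw [h0, mul_zero] at h1
  have h2 := (mul_eq_zero.1 h1.symm).resolve_left Complex.I_ne_zero
  linear_combination h2

/-- Bounds the pole's two contributions in `le_across`: m/d at the zero μ, at distance d, and 4m at
distance 1/4 inside the gap. -/
lemma mass_div_le {m C d : ℝ} (hm0 : 0 < m) (hm : m ≤ C / 2) (hd : 0 < d) (hCd : 2 ≤ C * d) :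
    m / d + 4 * m ≤ C / 2 * (C / 2 + 4) := by
  have h1 : m / d ≤ m * (C / 2) := by
    rw [div_le_iff₀ hd]
    nlinarith
  nlinarith

lemma IsMIF.le_right_of_spec {Θ : ℂ → ℂ} (h : IsMIF Θ) {C : ℝ}
    (hC : ∀ x : ℝ, ‖deriv Θ x‖ ≤ C) {q p b : ℝ} (hqp : q < p) (hqp1 : p - q ≤ 1)
    (hb : p + 1 / 4 < b) (hq : Θ q = 1) (hp : Θ p = 1) (hfree : ∀ u ∈ Ioo q p, Θ (u : ℂ) ≠ 1)
    (hpb : ∀ u ∈ Ioo p b, Θ (u : ℂ) ≠ 1) :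
    -(C / 2 * (C / 2 + 4)) ≤ (herglotz Θ (p + 1 / 4 : ℝ)).re := by
  obtain ⟨μ, hμ, hμ1, hμ0⟩ := h.exists_eq_neg_one hqp hq hp hfree
  have hd : 0 < p - μ := sub_pos.2 hμ.2
  have habs : |p - μ| = p - μ := abs_of_pos hd
  have h1 := h.le_across hp hfree hpb hμ (y := p + 1 / 4) ⟨by linarith, hb⟩
  have h2 := h.two_le_mul_abs_sub hC hp hμ1
  have h3 := h.mass_le hC hp hμ1 (by rw [habs]; linarith [hμ.1])
  rw [habs] at h2
  have h4 := mass_div_le (h.mass_pos (hfree μ hμ) hp) h3 hd h2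
  have h5 : mass Θ p / (p - (p + 1 / 4)) = -(4 * mass Θ p) := by
    rw [show p - (p + 1 / 4) = -(1 / 4) by ring]
    ring
  rw [hμ0, h5] at h1
  linarith

lemma IsMIF.left_of_spec_le {Θ : ℂ → ℂ} (h : IsMIF Θ) {C : ℝ}
    (hC : ∀ x : ℝ, ‖deriv Θ x‖ ≤ C) {a p q : ℝ} (hpq : p < q) (hpq1 : q - p ≤ 1)
    (ha : a < p - 1 / 4) (hq : Θ q = 1) (hp : Θ p = 1) (hfree : ∀ u ∈ Ioo p q, Θ (u : ℂ) ≠ 1)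
    (hap : ∀ u ∈ Ioo a p, Θ (u : ℂ) ≠ 1) :
    (herglotz Θ (p - 1 / 4 : ℝ)).re ≤ C / 2 * (C / 2 + 4) := by
  obtain ⟨μ, hμ, hμ1, hμ0⟩ := h.exists_eq_neg_one hpq hp hq hfree
  have hd : 0 < μ - p := sub_pos.2 hμ.1
  have habs : |p - μ| = μ - p := by rw [abs_sub_comm, abs_of_pos hd]
  have h1 := h.le_across hp hap hfree (x := p - 1 / 4) ⟨ha, by linarith⟩ hμ
  have h2 := h.two_le_mul_abs_sub hC hp hμ1
  have h3 := h.mass_le hC hp hμ1 (by rw [habs]; linarith [hμ.2])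
  rw [habs] at h2
  have h4 := mass_div_le (h.mass_pos (hfree μ hμ) hp) h3 hd h2
  have h5 : mass Θ p / (p - (p - 1 / 4)) = 4 * mass Θ p := by
    rw [show p - (p - 1 / 4) = 1 / 4 by ring]
    ring
  have h6 : mass Θ p / (p - μ) = -(mass Θ p / (μ - p)) := by
    rw [← neg_sub μ p, div_neg]
  rw [hμ0, h5, h6] at h1
  linarith

/-! ### Logarithmic growth across a gap -/

/-- The increase of the Herglotz function over a gap of length `k + 1` preceded by a run of
`k + 1` spectral points at unit distances is at least logarithmic. -/
lemma IsMIF.gap_increase {Θ : ℂ → ℂ} (h : IsMIF Θ) {C : ℝ} (hC0 : 0 < C)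
    (hC : ∀ x : ℝ, ‖deriv Θ x‖ ≤ C) {L : ℝ} {k : ℕ}
    (hL : ∀ i : ℕ, i ≤ k → Θ ((L - i : ℝ) : ℂ) = 1)
    (hgap : ∀ u ∈ Ioo L (L + k + 1), Θ (u : ℂ) ≠ 1) :
    2 / C * (∑ i ∈ Finset.range (k + 1), 1 / ((i : ℝ) + 1) - 2) ≤
      (herglotz Θ (L + k + 1 - 1 / 4 : ℝ)).re - (herglotz Θ (L + 1 / 4 : ℝ)).re := by
  have hk : (0 : ℝ) ≤ k := k.cast_nonneg
  have m1 : L + 1 / 4 ∈ Ioo L (L + k + 1) := ⟨by linarith, by linarith⟩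
  have m2 : L + k + 1 - 1 / 4 ∈ Ioo L (L + k + 1) := ⟨by linarith, by linarith⟩
  have ht := hgap _ m1
  set S : Finset ℝ := (Finset.range (k + 1)).image fun i : ℕ => L - (i : ℝ) with hS
  have hSspec : ∀ x ∈ S, Θ (x : ℂ) = 1 := by
    intro x hx
    obtain ⟨i, hi, rfl⟩ := Finset.mem_image.1 hx
    exact hL i (Nat.lt_succ_iff.1 (Finset.mem_range.1 hi))
  have key := h.monotoneOn_sub_poles ht hSspec hgap m1 m2 (by linarith)
  have hinj : Set.InjOn (fun i : ℕ => L - (i : ℝ)) (Finset.range (k + 1)) := by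
    intro i _ j _ hij
    have : (i : ℝ) = j := by simpa using hij
    exact_mod_cast this
  simp only [hS] at key
  rw [Finset.sum_image hinj, Finset.sum_image hinj] at key
  have hsum : 2 / C * (∑ i ∈ Finset.range (k + 1), 1 / ((i : ℝ) + 1) - 2) ≤
      ∑ i ∈ Finset.range (k + 1), mass Θ (L - i) * (1 / (L - i - (L + k + 1 - 1 / 4))) -
      ∑ i ∈ Finset.range (k + 1), mass Θ (L - i) * (1 / (L - i - (L + 1 / 4))) := by
    -- The 2 is spread evenly over the k + 1 poles, which allows a termwise comparison.
    have e : ∑ i ∈ Finset.range (k + 1), 1 / ((i : ℝ) + 1) - 2 =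
        ∑ i ∈ Finset.range (k + 1), (1 / ((i : ℝ) + 1) - 2 / ((k : ℝ) + 1)) := by
      rw [Finset.sum_sub_distrib, Finset.sum_const, Finset.card_range, nsmul_eq_mul]
      push_cast
      field_simp
    rw [e, Finset.mul_sum, ← Finset.sum_sub_distrib]
    refine Finset.sum_le_sum fun i hi => ?_
    have hi0 : (0 : ℝ) ≤ i := i.cast_nonneg
    have e1 : 1 / (L - i - (L + k + 1 - 1 / 4)) = -(1 / ((i : ℝ) + k + 3 / 4)) := by
      rw [← one_div_neg_eq_neg_one_div]
      congr 1
      ring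
    have e2 : 1 / (L - i - (L + 1 / 4)) = -(1 / ((i : ℝ) + 1 / 4)) := by
      rw [← one_div_neg_eq_neg_one_div]
      congr 1
      ring
    have hm := h.le_mass ht hC (hL i (Nat.lt_succ_iff.1 (Finset.mem_range.1 hi)))
    rw [e1, e2]
    have g1 : 1 / ((i : ℝ) + 1) ≤ 1 / ((i : ℝ) + 1 / 4) := by
      gcongr
      norm_num
    have g2 : 1 / ((i : ℝ) + k + 3 / 4) ≤ 2 / ((k : ℝ) + 1) := by
      rw [div_le_div_iff₀ (by positivity) (by positivity)]
      linarith
    -- Each pole's increment is nonnegative, so its mass may be replaced by the lower bound 2/C.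
    have g3 : 1 / ((i : ℝ) + k + 3 / 4) ≤ 1 / ((i : ℝ) + 1 / 4) := by
      gcongr 1 / ?_
      linarith
    calc 2 / C * (1 / ((i : ℝ) + 1) - 2 / ((k : ℝ) + 1))
        ≤ 2 / C * (1 / ((i : ℝ) + 1 / 4) - 1 / ((i : ℝ) + k + 3 / 4)) := by
          gcongr
      _ ≤ mass Θ (L - i) * (1 / ((i : ℝ) + 1 / 4) - 1 / ((i : ℝ) + k + 3 / 4)) :=
          mul_le_mul_of_nonneg_right hm (by linarith)
      _ = _ := by ring
  linarith

/-- A meromorphic inner function whose spectrum has arbitrarily long gaps, each preceded by an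
equally long run of points at unit distances and followed by two such points, has unbounded
derivative. -/
theorem IsMIF.not_hasBoundedDeriv_of_gaps {Θ : ℂ → ℂ} (h : IsMIF Θ)
    (hgaps : ∀ k : ℕ, 1 ≤ k → ∃ L : ℝ, (∀ i : ℕ, i ≤ k → L - i ∈ spec Θ) ∧
      L + k + 1 ∈ spec Θ ∧ L + k + 1 + 1 ∈ spec Θ ∧
      (∀ u ∈ Ioo (L - 1) L, u ∉ spec Θ) ∧ (∀ u ∈ Ioo L (L + k + 1), u ∉ spec Θ) ∧
      ∀ u ∈ Ioo (L + k + 1) (L + k + 1 + 1), u ∉ spec Θ) :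
    ¬ HasBoundedDeriv Θ := by
  rintro ⟨C', hC'⟩
  set C := max C' 1 with hCdef
  have hC : ∀ x : ℝ, ‖deriv Θ x‖ ≤ C := fun x => (hC' x).trans (le_max_left _ _)
  have hC0 : 0 < C := lt_of_lt_of_le one_pos (le_max_right _ _)
  have hdiv := (Real.tendsto_sum_range_one_div_nat_succ_atTop.comp (tendsto_add_atTop_nat 1))
  -- The threshold makes the growth (2/C)(H_{k+1} - 2) exceed twice the end-point bound (C/2)(C/2 +
  -- 4).
  obtain ⟨k, hk1, hk⟩ := ((hdiv.eventually (eventually_gt_atTop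
    (C / 2 * (2 * (C / 2 * (C / 2 + 4))) + 2))).and (eventually_ge_atTop 1)).exists
  obtain ⟨L, hL, hR, hR1, f1, f2, f3⟩ := hgaps k hk
  have hk0 : (1 : ℝ) ≤ k := by exact_mod_cast hk
  have hL0 : Θ (L : ℂ) = 1 := by simpa [spec] using hL 0 (Nat.zero_le k)
  have hL1 : Θ ((L - 1 : ℝ) : ℂ) = 1 := by
    have := hL 1 hk
    rwa [Nat.cast_one] at this
  have b1 := h.le_right_of_spec hC (q := L - 1) (p := L) (b := L + k + 1) (by linarith)
    (by linarith) (by linarith) hL1 hL0 f1 f2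
  have b2 := h.left_of_spec_le hC (a := L) (p := L + k + 1) (q := L + k + 1 + 1) (by linarith)
    (by linarith) (by linarith) hR1 hR f3 f2
  have b3 := h.gap_increase hC0 hC hL f2
  simp only [Function.comp] at hk1
  have b4 : 2 / C * (C / 2 * (2 * (C / 2 * (C / 2 + 4)))) <
      2 / C * (∑ i ∈ Finset.range (k + 1), 1 / ((i : ℝ) + 1) - 2) := by
    gcongr
    linarith
  have b5 : 2 / C * (C / 2 * (2 * (C / 2 * (C / 2 + 4)))) = 2 * (C / 2 * (C / 2 + 4)) := by
    field_simp
  linarith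

/-! ### Arithmetic of the removed blocks -/

/-- Block j ends before the run of k points preceding 2^(3^k); the same bound also clears the two
points kept after each block. -/
lemma two_pow_three_pow_add_lt {j k : ℕ} (hjk : j < k) :
    2 ^ 3 ^ j + j + k < 2 ^ 3 ^ k := by
  obtain ⟨l, rfl⟩ : ∃ l, k = l + 1 := ⟨k - 1, by omega⟩
  have h1 : 2 ^ 3 ^ j ≤ 2 ^ 3 ^ l :=
    Nat.pow_le_pow_right (by norm_num) (Nat.pow_le_pow_right (by norm_num) (by omega))
  have h2 : l < 3 ^ l := Nat.lt_pow_self (by norm_num)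
  have h3 : 3 ^ l < 2 ^ 3 ^ l := Nat.lt_pow_self (by norm_num)
  have h4 : 2 ^ 3 ^ (l + 1) = (2 ^ 3 ^ l) ^ 3 := by
    rw [pow_succ, pow_mul]
  rw [h4]
  generalize 2 ^ 3 ^ l = x at *
  have h5 : 4 * x ≤ x ^ 3 := by
    have : 2 * 2 ≤ x * x := Nat.mul_le_mul (by omega) (by omega)
    calc 4 * x ≤ x * x * x := Nat.mul_le_mul_right x this
      _ = x ^ 3 := by ring
  omega

lemma natCast_mem_removed {n : ℕ} :
    (n : ℝ) ∈ removed ↔ ∃ k m : ℕ, 1 ≤ m ∧ m ≤ k ∧ n = 2 ^ 3 ^ k + m := by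
  constructor
  · rintro ⟨k, m, h1, h2, h3⟩
    exact ⟨k, m, h1, h2, by exact_mod_cast h3⟩
  · rintro ⟨k, m, h1, h2, rfl⟩
    exact ⟨k, m, h1, h2, by push_cast; rfl⟩

lemma natCast_notMem_removed {k n : ℕ} (hk : 1 ≤ k)
    (hn : (2 ^ 3 ^ k ≤ n + k ∧ n ≤ 2 ^ 3 ^ k) ∨
      (2 ^ 3 ^ k + k + 1 ≤ n ∧ n ≤ 2 ^ 3 ^ k + k + 2)) : (n : ℝ) ∉ removed := by
  rw [natCast_mem_removed]
  rintro ⟨j, m, h1, h2, rfl⟩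
  rcases lt_trichotomy j k with h | rfl | h
  · have := two_pow_three_pow_add_lt h
    omega
  · omega
  · have := two_pow_three_pow_add_lt h
    omega

lemma notMem_Ioo_of_subset_range_int {S : Set ℝ} (hS : S ⊆ range (fun n : ℤ => (n : ℝ)))
    (a : ℤ) : ∀ u ∈ Ioo (a : ℝ) (a + 1), u ∉ S := by
  intro u hu huS
  obtain ⟨n, rfl⟩ := hS huS
  have h1 : a < n := by exact_mod_cast (show (a : ℝ) < (n : ℝ) from hu.1)
  have h2 : n < a + 1 := by exact_mod_cast (show (n : ℝ) < (a : ℝ) + 1 from hu.2)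
  omega

lemma exists_gaps {S : Set ℝ} (hS : S ⊆ range (fun n : ℤ => (n : ℝ)))
    (hSr : ∀ u ∈ S, u ∉ removed) (hSn : ∀ n : ℕ, 1 ≤ n → (n : ℝ) ∉ removed → (n : ℝ) ∈ S)
    (k : ℕ) (hk : 1 ≤ k) : ∃ L : ℝ, (∀ i : ℕ, i ≤ k → L - i ∈ S) ∧
      L + k + 1 ∈ S ∧ L + k + 1 + 1 ∈ S ∧
      (∀ u ∈ Ioo (L - 1) L, u ∉ S) ∧ (∀ u ∈ Ioo L (L + k + 1), u ∉ S) ∧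
      ∀ u ∈ Ioo (L + k + 1) (L + k + 1 + 1), u ∉ S := by
  -- Gives k + 2 < N, so the whole run N - k, ..., N consists of positive integers.
  have hkN := two_pow_three_pow_add_lt (j := 0) (k := k) (by omega)
  obtain ⟨N, hN⟩ : ∃ N : ℕ, N = 2 ^ 3 ^ k := ⟨_, rfl⟩
  have hcast : ((2 : ℝ) ^ 3 ^ k) = N := by rw [hN]; push_cast; rfl
  rw [← hN] at hkN
  refine ⟨N, fun i hi => ?_, ?_, ?_, ?_, ?_, ?_⟩
  · have e : (N : ℝ) - i = ((N - i : ℕ) : ℝ) := by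
      rw [Nat.cast_sub (by omega)]
    rw [e]
    exact hSn _ (by omega) (natCast_notMem_removed hk (Or.inl (by omega)))
  · have := hSn (N + k + 1) (by omega) (natCast_notMem_removed hk (Or.inr (by omega)))
    exact_mod_cast this
  · have := hSn (N + k + 1 + 1) (by omega) (natCast_notMem_removed hk (Or.inr (by omega)))
    exact_mod_cast this
  · have := notMem_Ioo_of_subset_range_int hS ((N : ℤ) - 1)
    push_cast at this
    simpa using this
  · intro u hu huS
    obtain ⟨n, rfl⟩ := hS huS
    have h1 : (N : ℤ) < n := by exact_mod_cast (show (N : ℝ) < (n : ℝ) from hu.1)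
    have h2 : n < (N : ℤ) + k + 1 := by exact_mod_cast (show (n : ℝ) < (N : ℝ) + k + 1 from hu.2)
    lift n to ℕ using by omega
    -- An integer inside the gap is N + m with 1 ≤ m ≤ k, hence removed.
    refine hSr _ huS ⟨k, n - N, by omega, by omega, ?_⟩
    rw [hcast, Nat.cast_sub (by omega)]
    simp
  · have := notMem_Ioo_of_subset_range_int hS ((N : ℤ) + k + 1)
    push_cast at this
    exact this

/-! ### Counting functions and regularity -/

lemma oneSidedSeq_subset_range : oneSidedSeq ⊆ range (fun n : ℤ => (n : ℝ)) := by
  rintro u ⟨⟨n, _, rfl⟩, _⟩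
  exact ⟨n, by simp⟩

lemma isSeparated_of_subset_range_int {S : Set ℝ} (hS : S ⊆ range (fun n : ℤ => (n : ℝ))) :
    IsSeparated S := by
  refine ⟨1 / 2, by norm_num, fun x hx y hy hxy => ?_⟩
  obtain ⟨n, rfl⟩ := hS hx
  obtain ⟨m, rfl⟩ := hS hy
  have h1 : n - m ≠ 0 := fun h => hxy (by rw [sub_eq_zero.1 h])
  have h2 : (1 : ℝ) ≤ |(n : ℝ) - m| := by exact_mod_cast Int.one_le_abs h1
  linarith

lemma finite_inter_Ioc {S : Set ℝ} (hS : S ⊆ range (fun n : ℤ => (n : ℝ))) (a b : ℝ) :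
    (S ∩ Ioc a b).Finite := by
  refine ((Set.finite_Ioc ⌊a⌋ ⌊b⌋).image (fun n : ℤ => (n : ℝ))).subset ?_
  rintro u ⟨hu, h1, h2⟩
  obtain ⟨n, rfl⟩ := hS hu
  exact ⟨n, ⟨Int.floor_lt.2 h1, Int.le_floor.2 h2⟩, rfl⟩

lemma monotone_counting {S : Set ℝ} (hS : S ⊆ range (fun n : ℤ => (n : ℝ))) :
    Monotone (counting S) := by
  intro x y hxy
  unfold counting
  split_ifs with h1 h2 h2
  · exact_mod_cast ncard_le_ncard (inter_subset_inter_right S (Ioc_subset_Ioc_right hxy))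
      (finite_inter_Ioc hS 0 y)
  · exact absurd (h1.trans hxy) h2
  · exact (neg_nonpos.2 (Nat.cast_nonneg _)).trans (Nat.cast_nonneg _)
  · refine neg_le_neg ?_
    exact_mod_cast ncard_le_ncard (inter_subset_inter_right S (Ioc_subset_Ioc_left hxy))
      (finite_inter_Ioc hS x 0)

lemma pow_four_le_two_pow_three_pow (k : ℕ) : k ^ 4 ≤ 2 ^ 3 ^ k := by
  rcases Nat.lt_or_ge k 2 with h | h
  · interval_cases k <;> norm_num
  · have h1 : 4 * k ≤ 3 ^ k := by
      induction k, h using Nat.le_induction with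
      | base => norm_num
      | succ n hn ih =>
        rw [pow_succ]
        omega
    calc k ^ 4 ≤ (2 ^ k) ^ 4 := Nat.pow_le_pow_left (Nat.lt_two_pow_self).le 4
      _ = 2 ^ (4 * k) := by rw [← pow_mul, mul_comm]
      _ ≤ 2 ^ 3 ^ k := Nat.pow_le_pow_right (by norm_num) h1

/-- A removed point 2^(3^k) + m ≤ x has m ≤ k ≤ x^(1/4) because k⁴ ≤ 2^(3^k); hence at most √x pairs
(k, m). -/
lemma ncard_removed_inter_le (x : ℝ) :
    ((removed ∩ Ioc 0 x).ncard : ℝ) ≤ √x := by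
  set M := ⌊√(√x)⌋₊ with hM
  set P : Finset ℝ := (Finset.Icc 1 M ×ˢ Finset.Icc 1 M).image
    fun p : ℕ × ℕ => (2 : ℝ) ^ 3 ^ p.1 + (p.2 : ℝ) with hP
  have hsub : removed ∩ Ioc 0 x ⊆ (P : Set ℝ) := by
    rintro u ⟨⟨k, m, h1, h2, rfl⟩, -, hux⟩
    have hk : (k : ℝ) ^ 4 ≤ x := by
      have : ((k ^ 4 : ℕ) : ℝ) ≤ ((2 ^ 3 ^ k : ℕ) : ℝ) := by
        exact_mod_cast pow_four_le_two_pow_three_pow k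
      push_cast at this
      have hm : (0 : ℝ) ≤ m := m.cast_nonneg
      linarith
    have hkM : k ≤ M := by
      refine Nat.le_floor (Real.le_sqrt_of_sq_le (Real.le_sqrt_of_sq_le ?_))
      rw [← pow_mul]
      exact hk
    rw [hP, Finset.coe_image]
    exact ⟨(k, m), by simp; omega, rfl⟩
  have h1 : (removed ∩ Ioc 0 x).ncard ≤ M * M := by
    calc _ ≤ (P : Set ℝ).ncard := ncard_le_ncard hsub P.finite_toSet
      _ = P.card := ncard_coe_finset P
      _ ≤ (Finset.Icc 1 M ×ˢ Finset.Icc 1 M).card := Finset.card_image_le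
      _ = M * M := by simp
  have h2 : (M : ℝ) ≤ √(√x) := Nat.floor_le (Real.sqrt_nonneg _)
  calc ((removed ∩ Ioc 0 x).ncard : ℝ) ≤ ((M * M : ℕ) : ℝ) := by exact_mod_cast h1
    _ = M * M := by push_cast; rfl
    _ ≤ √(√x) * √(√x) := by gcongr
    _ = √x := Real.mul_self_sqrt (Real.sqrt_nonneg x)

/-- On the positive half-line the counting function of a set whose positive part is the set of
non-removed positive integers differs from `x` by at most `1 + √x`. -/
lemma abs_counting_sub_le {S : Set ℝ} (hS : S ∩ Ioi 0 = oneSidedSeq) {x : ℝ} (hx : 0 ≤ x) :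
    |counting S x - x| ≤ 1 + √x := by
  set T : Set ℝ := (fun n : ℕ => (n : ℝ)) '' Set.Icc 1 ⌊x⌋₊ with hT
  have hTn : T.ncard = ⌊x⌋₊ := by
    rw [hT, ncard_image_of_injective _ Nat.cast_injective, ← Finset.coe_Icc, ncard_coe_finset]
    simp
  have hTf : T.Finite := (Set.finite_Icc _ _).image _
  have hST : S ∩ Ioc 0 x = T \ (removed ∩ Ioc 0 x) := by
    have e : S ∩ Ioc 0 x = oneSidedSeq ∩ Iic x := by
      rw [← hS, inter_assoc, Ioi_inter_Iic]
    rw [e]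
    ext u
    constructor
    · rintro ⟨⟨⟨n, hn, rfl⟩, hr⟩, hux⟩
      exact ⟨⟨n, ⟨hn, Nat.le_floor hux⟩, rfl⟩, fun h => hr h.1⟩
    · rintro ⟨⟨n, ⟨hn1, hn2⟩, rfl⟩, hr⟩
      have h1 : (n : ℝ) ≤ x := (Nat.le_floor_iff hx).1 hn2
      have h2 : (0 : ℝ) < n := by exact_mod_cast hn1
      exact ⟨⟨⟨n, hn1, rfl⟩, fun h => hr ⟨h, h2, h1⟩⟩, h1⟩
  have hrf : (removed ∩ Ioc 0 x).Finite := by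
    refine finite_inter_Ioc ?_ 0 x
    rintro u ⟨k, m, _, _, rfl⟩
    exact ⟨2 ^ 3 ^ k + m, by push_cast; rfl⟩
  have hup : (S ∩ Ioc 0 x).ncard ≤ ⌊x⌋₊ := by
    rw [hST, ← hTn]
    exact ncard_le_ncard sdiff_subset hTf
  have hlo : ⌊x⌋₊ ≤ (S ∩ Ioc 0 x).ncard + (removed ∩ Ioc 0 x).ncard := by
    rw [hST, ← hTn]
    exact ncard_le_ncard_sdiff_add_ncard T _ hrf
  have hup' : ((S ∩ Ioc 0 x).ncard : ℝ) ≤ ⌊x⌋₊ := by exact_mod_cast hup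
  have hlo' : (⌊x⌋₊ : ℝ) ≤ (S ∩ Ioc 0 x).ncard + (removed ∩ Ioc 0 x).ncard := by
    exact_mod_cast hlo
  have h1 := Nat.floor_le hx
  have h2 := Nat.lt_floor_add_one x
  have h3 := ncard_removed_inter_le x
  have h4 := Real.sqrt_nonneg x
  rw [counting, if_pos hx, abs_le]
  constructor <;> linarith

lemma twoSidedSeq_inter_Ioi : twoSidedSeq ∩ Ioi 0 = oneSidedSeq := by
  ext u
  constructor
  · rintro ⟨⟨⟨n, rfl⟩, hr⟩, h0⟩
    have h1 : 0 < n := by exact_mod_cast (mem_Ioi.1 h0 : (0 : ℝ) < (n : ℝ))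
    lift n to ℕ using h1.le
    exact ⟨⟨n, by omega, by simp⟩, hr⟩
  · rintro ⟨⟨n, hn, rfl⟩, hr⟩
    exact ⟨⟨⟨n, by simp⟩, hr⟩, mem_Ioi.2 (by exact_mod_cast hn)⟩

lemma oneSidedSeq_subset_Ioi : oneSidedSeq ⊆ Ioi 0 := by
  rw [← twoSidedSeq_inter_Ioi]
  exact inter_subset_right

lemma abs_counting_twoSidedSeq_sub_le (x : ℝ) : |counting twoSidedSeq x - x| ≤ 1 + √|x| := by
  rcases le_or_gt 0 x with hx | hx
  · rw [abs_of_nonneg hx]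
    exact abs_counting_sub_le twoSidedSeq_inter_Ioi hx
  -- Removed points are positive, so on the negative side only the rounding error of ⌊x⌋ remains.
  · have e : twoSidedSeq ∩ Ioc x 0 = (fun n : ℤ => (n : ℝ)) '' Set.Ioc ⌊x⌋ 0 := by
      ext u
      constructor
      · rintro ⟨⟨⟨n, rfl⟩, _⟩, h1, h2⟩
        exact ⟨n, ⟨Int.floor_lt.2 h1, by exact_mod_cast (show (n : ℝ) ≤ 0 from h2)⟩, rfl⟩
      · rintro ⟨n, ⟨h1, h2⟩, rfl⟩
        have h3 : (n : ℝ) ≤ 0 := by exact_mod_cast h2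
        refine ⟨⟨⟨n, rfl⟩, ?_⟩, Int.floor_lt.1 h1, h3⟩
        rintro ⟨k, m, _, _, h4⟩
        have h4 : (n : ℝ) = 2 ^ 3 ^ k + m := h4
        have : (0 : ℝ) < 2 ^ 3 ^ k + m := by positivity
        linarith
    have hfl : ⌊x⌋ ≤ 0 := Int.floor_nonpos hx.le
    have hn : ((twoSidedSeq ∩ Ioc x 0).ncard : ℝ) = -(⌊x⌋ : ℝ) := by
      rw [e, ncard_image_of_injective _ Int.cast_injective, ← Finset.coe_Ioc, ncard_coe_finset,
        Int.card_Ioc]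
      have : ((0 - ⌊x⌋).toNat : ℤ) = -⌊x⌋ := by omega
      exact_mod_cast congrArg (fun n : ℤ => (n : ℝ)) this
    rw [counting, if_neg (not_le.2 hx), hn, neg_neg, abs_le]
    have h1 := Int.floor_le x
    have h2 := Int.lt_floor_add_one x
    have h3 := Real.sqrt_nonneg |x|
    constructor <;> linarith

lemma one_add_sqrt_abs_le (x : ℝ) : 1 + √|x| ≤ 2 * (1 + ‖x‖ ^ 2) ^ (1 / 4 : ℝ) := by
  have h1 : (1 : ℝ) ≤ (1 + ‖x‖ ^ 2) ^ (1 / 4 : ℝ) :=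
    Real.one_le_rpow (by nlinarith [sq_nonneg ‖x‖]) (by norm_num)
  have h2 : √|x| ≤ (1 + ‖x‖ ^ 2) ^ (1 / 4 : ℝ) := by
    calc √|x| = (‖x‖ ^ 2) ^ (1 / 4 : ℝ) := by
          rw [Real.sqrt_eq_rpow, ← Real.rpow_natCast, ← Real.rpow_mul (norm_nonneg x),
            Real.norm_eq_abs]
          norm_num
      _ ≤ _ := by gcongr; linarith
  linarith

/-- The exponent 1/4 - 1 = -3/4 is written -(3/2)/2 to match the integrability criterion for (1 +
‖x‖²)^(-r/2), which needs r = 3/2 > 1. -/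
lemma norm_counting_div_le {S : Set ℝ} {x : ℝ} (h : |counting S x - x| ≤ 1 + √|x|) :
    ‖|counting S x - 1 * x| / (1 + x ^ 2)‖ ≤ 2 * (1 + ‖x‖ ^ 2) ^ (-(3 / 2) / 2 : ℝ) := by
  have hp : 0 < 1 + ‖x‖ ^ 2 := by positivity
  have e : 1 + x ^ 2 = 1 + ‖x‖ ^ 2 := by rw [Real.norm_eq_abs, sq_abs]
  rw [one_mul, Real.norm_of_nonneg (by positivity), e, div_le_iff₀ hp]
  have e2 : 2 * (1 + ‖x‖ ^ 2) ^ (-(3 / 2) / 2 : ℝ) * (1 + ‖x‖ ^ 2) =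
      2 * (1 + ‖x‖ ^ 2) ^ (1 / 4 : ℝ) := by
    rw [mul_assoc, ← Real.rpow_add_one hp.ne']
    norm_num
  rw [e2]
  exact h.trans (one_add_sqrt_abs_le x)

lemma integrable_majorant :
    Integrable (fun x : ℝ => 2 * (1 + ‖x‖ ^ 2) ^ (-(3 / 2) / 2 : ℝ)) volume :=
  (integrable_rpow_neg_one_add_norm_sq (by simp; norm_num)).const_mul 2

lemma measurable_counting_div {S : Set ℝ} (hS : S ⊆ range (fun n : ℤ => (n : ℝ))) :
    Measurable fun x : ℝ => |counting S x - 1 * x| / (1 + x ^ 2) := by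
  have := (monotone_counting hS).measurable
  fun_prop

lemma isOneSidedRegular_oneSidedSeq : IsOneSidedRegular 1 oneSidedSeq := by
  refine ⟨oneSidedSeq_subset_Ioi, isSeparated_of_subset_range_int oneSidedSeq_subset_range, ?_⟩
  refine Integrable.mono' integrable_majorant.integrableOn
    (measurable_counting_div oneSidedSeq_subset_range).aestronglyMeasurable ?_
  refine ae_restrict_of_forall_mem measurableSet_Ioi fun x hx => norm_counting_div_le ?_
  have hx : 0 < x := hx
  rw [abs_of_pos hx]
  exact abs_counting_sub_le (inter_eq_left.2 oneSidedSeq_subset_Ioi) hx.le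

lemma isRegular_twoSidedSeq : IsRegular 1 twoSidedSeq :=
  ⟨isSeparated_of_subset_range_int sdiff_subset, Integrable.mono' integrable_majorant
    (measurable_counting_div sdiff_subset).aestronglyMeasurable
    (Eventually.of_forall fun x => norm_counting_div_le (abs_counting_twoSidedSeq_sub_le x))⟩

end MIF

theorem mainTheorem5 :
    (MIF.IsOneSidedRegular 1 MIF.oneSidedSeq ∧
      ∀ Θ : ℂ → ℂ, MIF.IsMIF Θ → MIF.spec Θ = MIF.oneSidedSeq → ¬ MIF.HasBoundedDeriv Θ) ∧
    (MIF.IsRegular 1 MIF.twoSidedSeq ∧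
      ∀ Θ : ℂ → ℂ, MIF.IsMIF Θ → MIF.spec Θ = MIF.twoSidedSeq → ¬ MIF.HasBoundedDeriv Θ) := by
  refine ⟨⟨MIF.isOneSidedRegular_oneSidedSeq, fun Θ h hs => ?_⟩,
    ⟨MIF.isRegular_twoSidedSeq, fun Θ h hs => ?_⟩⟩
  · refine h.not_hasBoundedDeriv_of_gaps ?_
    rw [hs]
    exact MIF.exists_gaps MIF.oneSidedSeq_subset_range (fun u hu => hu.2)
      fun n hn hr => ⟨⟨n, hn, rfl⟩, hr⟩
  · refine h.not_hasBoundedDeriv_of_gaps ?_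
    rw [hs]
    exact MIF.exists_gaps sdiff_subset (fun u hu => hu.2)
      fun n _ hr => ⟨⟨n, by simp⟩, hr⟩
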